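/- Let $n \geq 3$ be an integer and let $\mathbb{F} = \mathbb{R}$ or $\mathbb{F} = \mathbb{C}$. For a function $f : \mathbb{F} \to \mathbb{F}$ and a matrix $A = (a_{ij}) \in M_n(\mathbb{F})$, write $f[A] = (f(a_{ij}))$ for the matrix obtained by applying $f$ to each entry of $A$. Call $f$ a positive definite (respectively, positive semidefinite) sign preserver on $M_n(\mathbb{F})$ if, for every Hermitian matrix $A \in M_n(\mathbb{F})$ (that is, real symmetric when $\mathbb{F} = \mathbb{R}$), $A$ is positive definite (respectively, positive semidefinite) if and only if $f[A]$ is positive definite (respectively, positive semidefinite). Here positive definite and positive semidefinite matrices are Hermitian by definition. Then for every function $f : \mathbb{F} \to \mathbb{F}$ the following are equivalent: 1. $f$ is a positive definite sign preserver on $M_n(\mathbb{F})$. 2. $f$ is a positive semidefinite sign preserver on $M_n(\mathbb{F})$. 3. $f$ is a positive real multiple of a continuous field automorphism of $\mathbb{F}$. Moreover, condition 3 is equivalent to the following explicit description: if $\mathbb{F} = \mathbb{R}$, there is a real $c > 0$ such that $f(x) = cx$ for all $x \in \mathbb{R}$; if $\mathbb{F} = \mathbb{C}$, there is a real $c > 0$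 such that either $f(z) = cz$ for all $z \in \mathbb{C}$, or $f(z) = c\overline{z}$ for all $z \in \mathbb{C}$. -/

import Mathlib

open scoped ComplexOrder

/-- `f` is a positive definite sign preserver on `n × n` matrices over `F`: a Hermitian matrix `A`
is positive definite if and only if the entrywise image `f[A]` is. -/
def IsPosDefSignPreserver {F : Type*} [Ring F] [PartialOrder F] [StarRing F]
    (n : ℕ) (f : F → F) : Prop :=
  ∀ A : Matrix (Fin n) (Fin n) F, A.IsHermitian → (A.PosDef ↔ (A.map f).PosDef)

/-- `f` is a positive semidefinite sign preserver on `n × n` matrices over `F`: a Hermitian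
matrix `A` is positive semidefinite if and only if the entrywise image `f[A]` is. -/
def IsPosSemidefSignPreserver {F : Type*} [Ring F] [PartialOrder F] [StarRing F]
    (n : ℕ) (f : F → F) : Prop :=
  ∀ A : Matrix (Fin n) (Fin n) F, A.IsHermitian → (A.PosSemidef ↔ (A.map f).PosSemidef)

/-- `f` is a positive real multiple of a continuous field automorphism of `F`. -/
def IsPosMulContinuousAut {F : Type*} [Field F] [Algebra ℝ F] [TopologicalSpace F]
    (f : F → F) : Prop :=
  ∃ c : ℝ, 0 < c ∧ ∃ σ : F ≃+* F, Continuous σ ∧ ∀ z, f z = c • σ z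

/-!
A sign preserver is determined by its effect on a few matrices of size two and three.

*Reduction to small sizes.* Repeating the last row and column of an `m × m` matrix transfers the
semidefinite property from size `n` to size `m ≤ n`. In the definite case the new diagonal entries
have to be increased as well (`posDef_clampExtend`), which is always possible on the level of `f`
because `f` is unbounded on the positive reals. Either kind of sign preserver is thus a *weak* sign
preserver in sizes two and three (`IsWeakSignPreserver`): definite matrices have semidefinite
images, and only semidefinite matrices have definite images. Moreover `f` is positive on the
positive reals and `f 1 < f 2`. The rest uses these properties only.

*The positive half-line.* Size two gives `‖f b‖ ^ 2 ≤ f a * f d` for `‖b‖ ^ 2 < a * d` and the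
reverse inequality for `‖b‖ ^ 2 > a * d`; from these, `f` takes arbitrarily small and arbitrarily
large positive values, and `f 0 = 0`. For `a, b > 0` the matrix `[a, 0, a; 0, b, b; a, b, c]` is
definite if `c > a + b` and not semidefinite if `c < a + b`, so `f` is additive up to arbitrarily
small errors, and such a function is linear (`eq_mul_of_quasi_additive`): `f x = c * x` for `x > 0`.
No continuity is needed.

*All scalars.* Size two now gives `‖f z‖ = c * ‖z‖`. The matrix `distTest z w r` is definite for
`‖z - w‖ < r` and not semidefinite for `‖z - w‖ > r ≥ 0`, so `f / c` is an isometry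
(`IsWeakSignPreserver.norm_map_sub_map`). It fixes `0` and `1`, hence is the identity or the complex
conjugation. Conversely, both preserve the sign, since entrywise conjugation of a Hermitian matrix
is transposition.
-/

/-! ### Functions on the positive reals -/

/-- A positive function `h` on `(0, ∞)` that is midpoint convex in logarithmic coordinates (up to
an arbitrarily small enlargement) with `h 1 < h 2` is unbounded: its supremum `S` would satisfy
`S ^ 2 ≤ h 1 * S`. -/
theorem exists_lt_of_sq_le_mul {h : ℝ → ℝ} (hpos : ∀ x, 0 < x → 0 < h x) (h12 : h 1 < h 2)
    (hconv : ∀ a b d, 0 < a → 0 < b → 0 < d → b ^ 2 < a * d → h b ^ 2 ≤ h a * h d) (M : ℝ) :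
    ∃ d, 0 < d ∧ M < h d := by
  by_contra! hM
  have hbdd : BddAbove (h '' Set.Ioi 0) := ⟨M, by rintro _ ⟨x, hx, rfl⟩; exact hM x hx⟩
  have hle : ∀ x, 0 < x → h x ≤ sSup (h '' Set.Ioi 0) := fun x hx => le_csSup hbdd ⟨x, hx, rfl⟩
  set S := sSup (h '' Set.Ioi 0)
  have h1 := hpos 1 one_pos
  have hS : 0 < S := h1.trans_le (hle 1 one_pos)
  have hsq : ∀ x, 0 < x → h x ≤ √(h 1 * S) := fun x hx => by
    refine Real.le_sqrt_of_sq_le ?_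
    calc h x ^ 2 ≤ h 1 * h (x ^ 2 + 1) := hconv _ _ _ one_pos hx (by positivity) (by linarith)
      _ ≤ h 1 * S := by gcongr; exact hle _ (by positivity)
  have hS' : S ≤ √(h 1 * S) :=
    csSup_le (Set.Nonempty.image _ Set.nonempty_Ioi) (by rintro _ ⟨x, hx, rfl⟩; exact hsq x hx)
  have hS2 : S ^ 2 ≤ h 1 * S := (Real.le_sqrt hS.le (by positivity)).1 hS'
  have : S ≤ h 1 := le_of_mul_le_mul_right (by linarith) hS
  linarith [hle 2 two_pos]

/-- An unbounded positive function on `(0, ∞)` that is midpoint concave in logarithmic coordinates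
(up to an arbitrarily small shrinking) takes arbitrarily small values. -/
theorem exists_lt_of_mul_le_sq {h : ℝ → ℝ} (hpos : ∀ x, 0 < x → 0 < h x)
    (hconc : ∀ a b d, 0 < a → 0 < b → 0 < d → a * d < b ^ 2 → h a * h d ≤ h b ^ 2)
    (hunb : ∀ M, ∃ d, 0 < d ∧ M < h d) {ε : ℝ} (hε : 0 < ε) : ∃ a, 0 < a ∧ h a < ε := by
  obtain ⟨d, hd, hlt⟩ := hunb (h 1 ^ 2 / ε)
  refine ⟨1 / (2 * d), by positivity, ?_⟩
  have := hconc (1 / (2 * d)) 1 d (by positivity) one_pos hd (by field_simp; norm_num)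
  rw [div_lt_iff₀ hε] at hlt
  exact lt_of_mul_lt_mul_right (a := h d) (by linarith) (hpos d hd).le

/-- A positive function on `(0, ∞)` with `h a + h b ≤ h c` for `a + b < c` and
`h c ≤ h a + h b` for `c < a + b` is linear, with no continuity assumed: comparing integer
multiples gives `m / k < c / a → m / k ≤ h c / h a`, hence `c / a ≤ h c / h a` for all `a` and
`c`, and exchanging `a` with `c` gives the equality. -/
theorem eq_mul_of_quasi_additive {h : ℝ → ℝ} (hpos : ∀ x, 0 < x → 0 < h x)
    (hsup : ∀ a b c, 0 < a → 0 < b → 0 < c → a + b < c → h a + h b ≤ h c)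
    (hsub : ∀ a b c, 0 < a → 0 < b → 0 < c → c < a + b → h c ≤ h a + h b) {x : ℝ} (hx : 0 < x) :
    h x = h 1 * x := by
  have hlow : ∀ (m : ℕ) (a c : ℝ), 0 < a → 0 < c → (m + 1 : ℕ) * a < c →
      (m + 1 : ℕ) * h a ≤ h c := by
    intro m
    induction m with
    | zero =>
      intro a c ha hc hac
      have := hsup a ((c - a) / 2) c ha (by norm_num at hac; linarith) hc
        (by norm_num at hac; linarith)
      have := hpos ((c - a) / 2) (by norm_num at hac; linarith)
      norm_num
      linarith
    | succ m ih =>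
      intro a c ha hc hac
      push_cast at hac ih ⊢
      -- leave half of the slack to the sum of the first `m + 1` copies of `a`
      have hma : 0 < ((m : ℝ) + 1) * a := by positivity
      have hb : 0 < ((m + 1) * a + (c - a)) / 2 := by nlinarith
      have h1 := ih a (((m + 1) * a + (c - a)) / 2) ha hb (by linarith)
      have h2 := hsup a _ c ha hb hc (by linarith)
      linarith
  have hup : ∀ (m : ℕ) (a c : ℝ), 0 < a → 0 < c → c < (m + 1 : ℕ) * a →
      h c ≤ (m + 1 : ℕ) * h a := by
    intro m
    induction m with
    | zero =>
      intro a c ha hc hac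
      have := hlow 0 c a hc ha (by simpa using hac)
      simpa using this
    | succ m ih =>
      intro a c ha hc hac
      push_cast at hac ih ⊢
      have hma : 0 < ((m : ℝ) + 1) * a := by positivity
      obtain ⟨b, hb1, hb2⟩ := exists_between (max_lt (show c - a < (m + 1) * a by linarith) hma)
      have hb : 0 < b := (le_max_right _ _).trans_lt hb1
      have h1 := ih a b ha hb hb2
      have h2 := hsub a b c ha hb hc (by linarith [(le_max_left (c - a) 0).trans_lt hb1])
      linarith
  have key : ∀ a c : ℝ, 0 < a → 0 < c → c / a ≤ h c / h a := by
    intro a c ha hc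
    have hca : 0 < h c / h a := div_pos (hpos c hc) (hpos a ha)
    by_contra! hlt
    obtain ⟨q, hq1, hq2⟩ := exists_rat_btwn hlt
    have hq0 : 0 < q := by exact_mod_cast hca.trans hq1
    obtain ⟨k, hk⟩ := Nat.exists_eq_succ_of_ne_zero q.den_nz
    obtain ⟨m, hm⟩ : ∃ m : ℕ, q.num = (m + 1 : ℕ) :=
      ⟨q.num.toNat - 1, by have := Rat.num_pos.2 hq0; omega⟩
    have hqe : (q : ℝ) = ((m + 1 : ℕ) : ℝ) / ((k + 1 : ℕ) : ℝ) := by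
      rw [Rat.cast_def, hk, hm]; push_cast; rfl
    rw [hqe, div_lt_div_iff₀ (by positivity) ha] at hq2
    rw [hqe, div_lt_div_iff₀ (hpos a ha) (by positivity)] at hq1
    obtain ⟨e, he1, he2⟩ := exists_between hq2
    have he : 0 < e := lt_trans (by positivity) he1
    have h1 := hlow m a e ha he he1
    have h2 := hup k c e hc he (by linarith)
    linarith
  have h1 := key 1 x one_pos hx
  have h2 := key x 1 hx one_pos
  have p1 := hpos 1 one_pos
  have px := hpos x hx
  rw [div_one, le_div_iff₀ p1] at h1
  rw [div_le_div_iff₀ hx px] at h2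
  linarith

/-! ### Hermitian test matrices -/

section TestMatrices

variable {K : Type*} [RCLike K]

open Matrix

/-- The Hermitian matrix with real diagonal `a, d` and upper off-diagonal entry `b`. -/
def hermTwo (a d : ℝ) (b : K) : Matrix (Fin 2) (Fin 2) K :=
  !![(a : K), b; starRingEnd K b, (d : K)]

/-- The real symmetric matrix `[a, 0, a; 0, b, b; a, b, c]`, of determinant `a b (c - a - b)`. -/
def addTest (K : Type*) [RCLike K] (a b c : ℝ) : Matrix (Fin 3) (Fin 3) K :=
  !![(a : K), 0, (a : K); 0, (b : K), (b : K); (a : K), (b : K), (c : K)]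

/-- The Hermitian matrix whose Schur complement with respect to the last diagonal entry is
`[r, z - w; conj (z - w), r]`. -/
def distTest (z w : K) (r : ℝ) : Matrix (Fin 3) (Fin 3) K :=
  !![((‖w‖ ^ 2 + r : ℝ) : K), z, w; starRingEnd K z, ((1 + r : ℝ) : K), 1; starRingEnd K w, 1, 1]

theorem det_hermTwo (a d : ℝ) (b : K) : (hermTwo a d b).det = ((a * d - ‖b‖ ^ 2 : ℝ) : K) := by
  rw [hermTwo, det_fin_two_of, RCLike.mul_conj]
  push_cast; ring

theorem det_addTest (a b c : ℝ) : (addTest K a b c).det = ((a * b * (c - a - b) : ℝ) : K) := by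
  simp [addTest, det_fin_three]
  ring

theorem det_distTest (z w : K) (r : ℝ) :
    (distTest z w r).det = ((r ^ 2 - ‖z - w‖ ^ 2 : ℝ) : K) := by
  have h1 := RCLike.mul_conj w
  have h2 := RCLike.mul_conj (z - w)
  simp only [map_sub] at h2
  simp [distTest, det_fin_three]
  linear_combination -(r : K) * h1 - h2

theorem isHermitian_hermTwo (a d : ℝ) (b : K) : (hermTwo a d b).IsHermitian := by
  ext i j; fin_cases i <;> fin_cases j <;> simp [hermTwo]

theorem isHermitian_addTest (a b c : ℝ) : (addTest K a b c).IsHermitian := by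
  ext i j; fin_cases i <;> fin_cases j <;> simp [addTest]

theorem isHermitian_distTest (z w : K) (r : ℝ) : (distTest z w r).IsHermitian := by
  ext i j; fin_cases i <;> fin_cases j <;> simp [distTest]

theorem posDef_hermTwo {a d : ℝ} {b : K} (ha : 0 < a) (h : ‖b‖ ^ 2 < a * d) :
    (hermTwo a d b).PosDef := by
  have haK : (a : K) ≠ 0 := by exact_mod_cast ha.ne'
  have hsum : hermTwo a d b =
      a • vecMulVec ![1, starRingEnd K b / a] (star ![1, starRingEnd K b / a])
      + diagonal ![0, ((d - ‖b‖ ^ 2 / a : ℝ) : K)] := by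
    have h1 := RCLike.mul_conj b
    ext i j; fin_cases i <;> fin_cases j <;>
      simp [hermTwo, -cons_vecMulVec, -vecMulVec_cons, vecMulVec_apply,
        RCLike.real_smul_eq_coe_mul] <;> field_simp
    linear_combination -h1
  have hpsd : (hermTwo a d b).PosSemidef := by
    rw [hsum]
    refine ((posSemidef_vecMulVec_self_star _).smul ha.le).add (.diagonal ?_)
    intro i
    fin_cases i
    · simp
    · exact RCLike.ofReal_nonneg.2 (sub_nonneg.2 ((div_le_iff₀ ha).2 (by linarith)))
  rw [hpsd.posDef_iff_det_ne_zero, det_hermTwo, Ne, RCLike.ofReal_eq_zero]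
  linarith

theorem norm_sq_le_of_posSemidef_hermTwo {a d : ℝ} {b : K} (h : (hermTwo a d b).PosSemidef) :
    ‖b‖ ^ 2 ≤ a * d := by
  have := h.det_nonneg
  rw [det_hermTwo, RCLike.ofReal_nonneg] at this
  linarith

theorem posDef_addTest {a b c : ℝ} (ha : 0 < a) (hb : 0 < b) (h : a + b < c) :
    (addTest K a b c).PosDef := by
  have hsum : addTest K a b c = a • vecMulVec ![1, 0, 1] (star ![1, 0, 1])
      + b • vecMulVec ![0, 1, 1] (star ![0, 1, 1]) + diagonal ![0, 0, ((c - a - b : ℝ) : K)] := by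
    ext i j; fin_cases i <;> fin_cases j <;>
      simp [addTest, -cons_vecMulVec, -vecMulVec_cons, vecMulVec_apply, RCLike.real_smul_eq_coe_mul]
  have hpsd : (addTest K a b c).PosSemidef := by
    rw [hsum]
    refine (((posSemidef_vecMulVec_self_star _).smul ha.le).add
      ((posSemidef_vecMulVec_self_star _).smul hb.le)).add (.diagonal ?_)
    intro i
    fin_cases i
    · simp
    · simp
    · exact RCLike.ofReal_nonneg.2 (by linarith)
  rw [hpsd.posDef_iff_det_ne_zero, det_addTest, Ne, RCLike.ofReal_eq_zero]
  have : 0 < a * b * (c - a - b) := mul_pos (mul_pos ha hb) (by linarith)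
  exact this.ne'

theorem add_le_of_posSemidef_addTest {a b c : ℝ} (ha : 0 < a) (hb : 0 < b)
    (h : (addTest K a b c).PosSemidef) : a + b ≤ c := by
  have := h.det_nonneg
  rw [det_addTest, RCLike.ofReal_nonneg] at this
  linarith [nonneg_of_mul_nonneg_right this (mul_pos ha hb)]

theorem posDef_distTest {z w : K} {r : ℝ} (h : ‖z - w‖ < r) : (distTest z w r).PosDef := by
  have hr : 0 < r := (norm_nonneg _).trans_lt h
  have hrK : (r : K) ≠ 0 := by exact_mod_cast hr.ne'
  have hsq : ‖z - w‖ ^ 2 < r ^ 2 := by gcongr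
  have hsum : distTest z w r = vecMulVec ![w, 1, 1] (star ![w, 1, 1])
      + r • vecMulVec ![1, starRingEnd K (z - w) / r, 0] (star ![1, starRingEnd K (z - w) / r, 0])
      + diagonal ![0, ((r - ‖z - w‖ ^ 2 / r : ℝ) : K), 0] := by
    have h1 := RCLike.mul_conj w
    have h2 := RCLike.mul_conj (z - w)
    simp only [map_sub] at h2
    ext i j; fin_cases i <;> fin_cases j <;>
      simp [distTest, -cons_vecMulVec, -vecMulVec_cons, vecMulVec_apply,
        RCLike.real_smul_eq_coe_mul, h1] <;> field_simp
    · ring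
    · ring
    · linear_combination -h2
  have hpsd : (distTest z w r).PosSemidef := by
    rw [hsum]
    refine ((posSemidef_vecMulVec_self_star _).add
      ((posSemidef_vecMulVec_self_star _).smul hr.le)).add (.diagonal ?_)
    intro i
    fin_cases i
    · simp
    · exact RCLike.ofReal_nonneg.2 (sub_nonneg.2 ((div_le_iff₀ hr).2 (by linarith)))
    · simp
  rw [hpsd.posDef_iff_det_ne_zero, det_distTest, Ne, RCLike.ofReal_eq_zero]
  linarith

theorem norm_sub_le_of_posSemidef_distTest {z w : K} {r : ℝ} (hr : 0 ≤ r)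
    (h : (distTest z w r).PosSemidef) : ‖z - w‖ ≤ r := by
  have := h.det_nonneg
  rw [det_distTest, RCLike.ofReal_nonneg] at this
  exact abs_le_of_sq_le_sq' (by linarith) hr |>.2

end TestMatrices

/-! ### Functions that weakly preserve positivity of small matrices -/

section Weak

variable {K : Type*} [RCLike K]

open Matrix

/-- `f` maps positive definite `m × m` matrices entrywise to positive semidefinite ones, and only
positive semidefinite Hermitian matrices have a positive definite image. Positive definite and
positive semidefinite sign preservers both have this property. -/
def IsWeakSignPreserver (m : ℕ) (f : K → K) : Prop :=
  (∀ A : Matrix (Fin m) (Fin m) K, A.PosDef → (A.map f).PosSemidef) ∧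
    ∀ A : Matrix (Fin m) (Fin m) K, A.IsHermitian → (A.map f).PosDef → A.PosSemidef

variable {f : K → K}

theorem map_conj_of_posSemidef_map
    (hf : ∀ A : Matrix (Fin 2) (Fin 2) K, A.PosDef → (A.map f).PosSemidef) (b : K) :
    f (starRingEnd K b) = starRingEnd K (f b) := by
  have hn := norm_nonneg b
  have h := (hf (hermTwo (‖b‖ + 1) (‖b‖ + 1) b)
    (posDef_hermTwo (by positivity) (by nlinarith))).isHermitian.apply 1 0
  simpa [hermTwo] using h.symm

theorem map_ofReal_of_posSemidef_map
    (hf : ∀ A : Matrix (Fin 2) (Fin 2) K, A.PosDef → (A.map f).PosSemidef) (a : ℝ) :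
    f a = (RCLike.re (f a) : K) := by
  have h := map_conj_of_posSemidef_map hf (a : K)
  rw [RCLike.conj_ofReal] at h
  exact (RCLike.conj_eq_iff_re.1 h.symm).symm

theorem map_hermTwo (hf : ∀ A : Matrix (Fin 2) (Fin 2) K, A.PosDef → (A.map f).PosSemidef)
    (a d : ℝ) (b : K) :
    (hermTwo a d b).map f = hermTwo (RCLike.re (f a)) (RCLike.re (f d)) (f b) := by
  ext i j
  fin_cases i <;> fin_cases j <;>
    simp [hermTwo, map_conj_of_posSemidef_map hf, ← map_ofReal_of_posSemidef_map hf]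

theorem norm_sq_map_le (hf : ∀ A : Matrix (Fin 2) (Fin 2) K, A.PosDef → (A.map f).PosSemidef)
    {a d : ℝ} {b : K} (ha : 0 < a) (h : ‖b‖ ^ 2 < a * d) :
    ‖f b‖ ^ 2 ≤ RCLike.re (f a) * RCLike.re (f d) := by
  have := hf _ (posDef_hermTwo ha h)
  rw [map_hermTwo hf] at this
  exact norm_sq_le_of_posSemidef_hermTwo this

theorem norm_map_ofReal_sq
    (hf : ∀ A : Matrix (Fin 2) (Fin 2) K, A.PosDef → (A.map f).PosSemidef) (a : ℝ) :
    ‖f (a : K)‖ ^ 2 = RCLike.re (f a) ^ 2 := by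
  conv_lhs => rw [map_ofReal_of_posSemidef_map hf, RCLike.norm_ofReal, sq_abs]

theorem exists_lt_re_map (hf : ∀ A : Matrix (Fin 2) (Fin 2) K, A.PosDef → (A.map f).PosSemidef)
    (hpos : ∀ x : ℝ, 0 < x → 0 < RCLike.re (f x))
    (h12 : RCLike.re (f (1 : ℝ)) < RCLike.re (f (2 : ℝ))) (M : ℝ) :
    ∃ d : ℝ, 0 < d ∧ M < RCLike.re (f d) := by
  refine exists_lt_of_sq_le_mul (h := fun x => RCLike.re (f x)) hpos h12 ?_ M
  intro a b d ha hb hd h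
  simp only [← norm_map_ofReal_sq hf]
  exact norm_sq_map_le hf ha (by simpa using h)

namespace IsWeakSignPreserver

theorem le_norm_sq_map (hf : IsWeakSignPreserver 2 f)
    (hpos : ∀ x : ℝ, 0 < x → 0 < RCLike.re (f x)) {a d : ℝ} {b : K} (ha : 0 < a)
    (h : a * d < ‖b‖ ^ 2) : RCLike.re (f a) * RCLike.re (f d) ≤ ‖f b‖ ^ 2 := by
  by_contra! hlt
  have := hf.2 _ (isHermitian_hermTwo a d b)
    (by rw [map_hermTwo hf.1]; exact posDef_hermTwo (hpos a ha) hlt)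
  linarith [norm_sq_le_of_posSemidef_hermTwo this]

theorem map_zero (hf : IsWeakSignPreserver 2 f) (hpos : ∀ x : ℝ, 0 < x → 0 < RCLike.re (f x))
    (h12 : RCLike.re (f (1 : ℝ)) < RCLike.re (f (2 : ℝ))) : f 0 = 0 := by
  have h1 := hpos 1 one_pos
  by_contra h0
  have hn : 0 < ‖f 0‖ := norm_pos_iff.2 h0
  obtain ⟨a, ha, hlt⟩ := exists_lt_of_mul_le_sq (h := fun x => RCLike.re (f x)) hpos (by
    intro a b d ha hb hd h
    simp only [← norm_map_ofReal_sq hf.1]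
    exact hf.le_norm_sq_map hpos ha (by simpa using h)) (exists_lt_re_map hf.1 hpos h12)
    (ε := ‖f 0‖ ^ 2 / RCLike.re (f (1 : ℝ))) (by positivity)
  rw [lt_div_iff₀ h1] at hlt
  exact absurd (norm_sq_map_le hf.1 (a := a) (d := 1) (b := 0) ha (by simpa using ha)) hlt.not_ge

/-- Additivity up to an arbitrarily small error comes from the matrices `addTest`. -/
theorem map_ofReal_pos (hf : IsWeakSignPreserver 2 f) (hf3 : IsWeakSignPreserver 3 f)
    (hpos : ∀ x : ℝ, 0 < x → 0 < RCLike.re (f x))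
    (h12 : RCLike.re (f (1 : ℝ)) < RCLike.re (f (2 : ℝ))) {x : ℝ} (hx : 0 < x) :
    RCLike.re (f x) = RCLike.re (f (1 : ℝ)) * x := by
  have hmap : ∀ a b c : ℝ, (addTest K a b c).map f =
      addTest K (RCLike.re (f a)) (RCLike.re (f b)) (RCLike.re (f c)) := by
    intro a b c
    ext i j
    fin_cases i <;> fin_cases j <;>
      simp [addTest, hf.map_zero hpos h12, ← map_ofReal_of_posSemidef_map hf.1]
  refine eq_mul_of_quasi_additive (h := fun x => RCLike.re (f x)) hpos ?_ ?_ hx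
  · intro a b c ha hb hc h
    have := hf3.1 _ (posDef_addTest ha hb h)
    rw [hmap] at this
    exact add_le_of_posSemidef_addTest (hpos a ha) (hpos b hb) this
  · intro a b c ha hb hc h
    by_contra! hlt
    have := hf3.2 _ (isHermitian_addTest a b c)
      (by rw [hmap]; exact posDef_addTest (hpos a ha) (hpos b hb) hlt)
    linarith [add_le_of_posSemidef_addTest ha hb this]

theorem norm_map (hf : IsWeakSignPreserver 2 f) (hpos : ∀ x : ℝ, 0 < x → 0 < RCLike.re (f x))
    {c : ℝ} (hc : 0 < c) (hlin : ∀ x : ℝ, 0 < x → RCLike.re (f x) = c * x) (z : K) :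
    ‖f z‖ = c * ‖z‖ := by
  have hz := norm_nonneg z
  have hfz := norm_nonneg (f z)
  apply le_antisymm
  · rw [← div_le_iff₀' hc]
    refine le_of_forall_gt_imp_ge_of_dense fun a ha => ?_
    have ha0 : 0 < a := hz.trans_lt ha
    have h := norm_sq_map_le hf.1 (a := a) (d := a) (b := z) ha0 (by nlinarith)
    rw [hlin a ha0] at h
    rw [div_le_iff₀' hc]
    exact abs_le_of_sq_le_sq' (by linarith) (by positivity) |>.2
  · rw [← le_div_iff₀' hc]
    refine le_of_forall_lt_imp_le_of_dense fun a ha => ?_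
    rcases le_or_gt a 0 with ha0 | ha0
    · exact ha0.trans (by positivity)
    have h := hf.le_norm_sq_map hpos (a := a) (d := a) (b := z) ha0 (by nlinarith)
    rw [hlin a ha0] at h
    rw [le_div_iff₀' hc]
    exact abs_le_of_sq_le_sq' (by linarith) hfz |>.2

/-- Up to the factor `c = f 1`, the function is an isometry; the matrices `distTest` detect
distances. -/
theorem norm_map_sub_map (hf : IsWeakSignPreserver 2 f) (hf3 : IsWeakSignPreserver 3 f)
    (hpos : ∀ x : ℝ, 0 < x → 0 < RCLike.re (f x)) {c : ℝ} (hc : 0 < c)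
    (hlin : ∀ x : ℝ, 0 < x → RCLike.re (f x) = c * x) (z w : K) :
    ‖f z - f w‖ = c * ‖z - w‖ := by
  have hcK : (c : K) ≠ 0 := by exact_mod_cast hc.ne'
  have hreal : ∀ x : ℝ, 0 < x → f x = (c : K) * x := fun x hx => by
    rw [map_ofReal_of_posSemidef_map hf.1, hlin x hx]; push_cast; rfl
  have h1 : f 1 = c := by simpa using hreal 1 one_pos
  have hnw : ‖(c : K)⁻¹ * f w‖ = ‖w‖ := by
    rw [norm_mul, norm_inv, RCLike.norm_ofReal, abs_of_pos hc, hf.norm_map hpos hc hlin]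
    field_simp
  have hmap : ∀ r : ℝ, 0 < r →
      (distTest z w r).map f = c • distTest ((c : K)⁻¹ * f z) ((c : K)⁻¹ * f w) r := by
    intro r hr
    have e1 := hreal (‖w‖ ^ 2 + r) (by positivity)
    have e2 := hreal (1 + r) (by positivity)
    push_cast at e1 e2
    ext i j
    fin_cases i <;> fin_cases j <;>
      simp [distTest, hnw, RCLike.real_smul_eq_coe_mul, e1, e2, h1,
        map_conj_of_posSemidef_map hf.1, hcK]
    · exact mul_add _ _ _
    · rw [mul_add, mul_one]
  have hdist : ‖(c : K)⁻¹ * f z - (c : K)⁻¹ * f w‖ = ‖z - w‖ := by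
    apply le_antisymm
    · refine le_of_forall_gt_imp_ge_of_dense fun r hr => ?_
      have hr0 : 0 < r := (norm_nonneg _).trans_lt hr
      have h := hf3.1 _ (posDef_distTest hr)
      rw [hmap r hr0] at h
      have h' := h.smul (inv_nonneg.2 hc.le)
      rw [smul_smul, inv_mul_cancel₀ hc.ne', one_smul] at h'
      exact norm_sub_le_of_posSemidef_distTest hr0.le h'
    · refine le_of_forall_gt_imp_ge_of_dense fun r hr => ?_
      have hr0 : 0 < r := (norm_nonneg _).trans_lt hr
      refine norm_sub_le_of_posSemidef_distTest hr0.le (hf3.2 _ (isHermitian_distTest z w r) ?_)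
      rw [hmap r hr0]
      exact (posDef_distTest hr).smul hc
  rw [← mul_sub, norm_mul, norm_inv, RCLike.norm_ofReal, abs_of_pos hc] at hdist
  rw [← hdist]
  field_simp

/-- A weak sign preserver is, up to a positive factor `c`, an isometry fixing `0` and `1`. -/
theorem exists_isometry (hf : IsWeakSignPreserver 2 f) (hf3 : IsWeakSignPreserver 3 f)
    (hpos : ∀ x : ℝ, 0 < x → 0 < RCLike.re (f x))
    (h12 : RCLike.re (f (1 : ℝ)) < RCLike.re (f (2 : ℝ))) :
    ∃ c : ℝ, 0 < c ∧ ∃ g : K → K, g 0 = 0 ∧ g 1 = 1 ∧ Isometry g ∧ ∀ z, f z = c * g z := by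
  have hc := hpos 1 one_pos
  have hcK : ((RCLike.re (f (1 : ℝ)) : ℝ) : K) ≠ 0 := by exact_mod_cast hc.ne'
  refine ⟨RCLike.re (f (1 : ℝ)), hc, fun z => ((RCLike.re (f (1 : ℝ)) : ℝ) : K)⁻¹ * f z, ?_, ?_, ?_,
    fun z => ?_⟩
  · simp [hf.map_zero hpos h12]
  · have := map_ofReal_of_posSemidef_map hf.1 1
    rw [← this]
    rw [← this] at hcK
    simpa using inv_mul_cancel₀ hcK
  · refine Isometry.of_dist_eq fun z w => ?_
    rw [dist_eq_norm, dist_eq_norm, ← mul_sub, norm_mul, norm_inv, RCLike.norm_ofReal,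
      abs_of_pos hc, hf.norm_map_sub_map hf3 hpos hc (fun x hx => hf.map_ofReal_pos hf3 hpos h12 hx)]
    field_simp
  · exact (mul_inv_cancel_left₀ hcK _).symm

end IsWeakSignPreserver

end Weak

/-! ### Reduction to small matrices -/

section BlowUp

variable {K : Type*} [RCLike K]

open Matrix

/-- Repeating rows and columns of a positive definite matrix along `g` and then enlarging the
diagonal outside a set on which `g` is injective gives a positive definite matrix. -/
theorem posDef_submatrix_add_diagonal {ι κ : Type*} [Fintype ι] [Fintype κ] [DecidableEq κ]
    [DecidableEq ι] {A : Matrix ι ι K} (hA : A.PosDef) (g : κ → ι) {t : κ → K} (ht : ∀ i, 0 ≤ t i)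
    (S : Set κ) (hS : Set.InjOn g S) (htS : ∀ i ∉ S, 0 < t i) :
    (A.submatrix g g + diagonal t).PosDef := by
  have hd : (diagonal t).PosSemidef := .diagonal ht
  have hs := hA.posSemidef.submatrix g
  refine .of_dotProduct_mulVec_pos (hs.add hd).isHermitian fun x hx => ?_
  rw [add_mulVec, dotProduct_add]
  by_cases h : ∃ i, i ∉ S ∧ x i ≠ 0
  · obtain ⟨i, hi, hxi⟩ := h
    refine add_pos_of_nonneg_of_pos (hs.dotProduct_mulVec_nonneg x) ?_
    simp only [dotProduct, mulVec_diagonal]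
    refine Finset.sum_pos' (fun j _ => ?_) ⟨i, Finset.mem_univ i, ?_⟩
    · rw [mul_left_comm, Pi.star_apply]
      exact mul_nonneg (ht j) (star_mul_self_nonneg _)
    · rw [mul_left_comm, Pi.star_apply]
      exact mul_pos (htS i hi) (star_mul_self_pos (IsRegular.of_ne_zero hxi))
  · push Not at h
    refine add_pos_of_pos_of_nonneg ?_ (hd.dotProduct_mulVec_nonneg x)
    have pull : ∀ (u : ι → K) (v : κ → K),
        ∑ k, u k * ∑ i with g i = k, v i = ∑ i, u (g i) * v i := by
      intro u v
      rw [← Finset.sum_fiberwise Finset.univ g]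
      refine Finset.sum_congr rfl fun k _ => ?_
      rw [Finset.mul_sum]
      refine Finset.sum_congr rfl fun i hi => ?_
      rw [(Finset.mem_filter.1 hi).2]
    -- the form of the blown-up matrix at `x` is that of `A` at the fibre sums of `x`
    have key : star x ⬝ᵥ (A.submatrix g g *ᵥ x) =
        star (fun k => ∑ i with g i = k, x i) ⬝ᵥ (A *ᵥ fun k => ∑ i with g i = k, x i) := by
      simp only [dotProduct, mulVec, Pi.star_apply, star_sum, submatrix_apply, pull]
      simp only [mul_comm (∑ i with g i = _, star (x i)), pull]
      exact Finset.sum_congr rfl fun _ _ => mul_comm _ _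
    rw [key]
    refine hA.dotProduct_mulVec_pos fun h0 => ?_
    obtain ⟨i, hxi⟩ := Function.ne_iff.1 hx
    have hiS : i ∈ S := by
      by_contra hi
      exact hxi (h i hi)
    have := congrFun h0 (g i)
    rw [Finset.sum_eq_single_of_mem i (by simp)] at this
    · exact hxi this
    · intro j hj hji
      by_contra hxj
      have hjS : j ∈ S := by
        by_contra hj'
        exact hxj (h j hj')
      exact hji (hS hjS hiS (Finset.mem_filter.1 hj).2)

/-- The map `Fin n → Fin m` that sends every `i ≥ m` to the last index. -/
def clampFin {m n : ℕ} (hm : 0 < m) (i : Fin n) : Fin m :=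
  ⟨min i (m - 1), by omega⟩

theorem clampFin_castLE {m n : ℕ} (hm : 0 < m) (hmn : m ≤ n) (i : Fin m) :
    clampFin hm (Fin.castLE hmn i) = i := by
  ext; simp [clampFin]; omega

theorem injOn_clampFin {m n : ℕ} (hm : 0 < m) :
    Set.InjOn (clampFin (n := n) hm) {i | (i : ℕ) < m} := by
  intro i hi j hj h
  have := congrArg Fin.val h
  simp only [clampFin, Set.mem_ofPred_eq] at this hi hj
  ext; omega

/-- The `n × n` matrix that repeats the last row and column of an `m × m` matrix and replaces the
diagonal entries of index `i ≥ m` by `d`. -/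
def clampExtend {R : Type*} {m n : ℕ} (hm : 0 < m) (A : Matrix (Fin m) (Fin m) R) (d : R) :
    Matrix (Fin n) (Fin n) R :=
  fun i j => if i = j ∧ m ≤ (i : ℕ) then d else A (clampFin hm i) (clampFin hm j)

theorem map_clampExtend {R : Type*} {m n : ℕ} (hm : 0 < m) (A : Matrix (Fin m) (Fin m) R) (d : R)
    (f : R → R) :
    (clampExtend hm A d : Matrix (Fin n) (Fin n) R).map f = clampExtend hm (A.map f) (f d) := by
  ext i j
  simp only [clampExtend, map_apply]
  split_ifs <;> rfl

theorem clampExtend_submatrix {R : Type*} {m n : ℕ} (hm : 0 < m) (hmn : m ≤ n)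
    (A : Matrix (Fin m) (Fin m) R) (d : R) :
    (clampExtend hm A d).submatrix (Fin.castLE hmn) (Fin.castLE hmn) = A := by
  ext i j
  have : ¬ m ≤ (i : ℕ) := by omega
  simp [clampExtend, clampFin_castLE, this]

theorem isHermitian_clampExtend {m n : ℕ} (hm : 0 < m) {A : Matrix (Fin m) (Fin m) K}
    (hA : A.IsHermitian) (d : ℝ) :
    (clampExtend hm A (d : K) : Matrix (Fin n) (Fin n) K).IsHermitian := by
  ext i j
  simp only [clampExtend, conjTranspose_apply]
  by_cases hij : i = j
  · subst hij
    split_ifs <;> simp [hA.apply]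
  · simp [hij, Ne.symm hij, hA.apply]

theorem posDef_clampExtend {m n : ℕ} (hm : 0 < m) {A : Matrix (Fin m) (Fin m) K}
    (hA : A.PosDef) {d : K} (hd : A ⟨m - 1, by omega⟩ ⟨m - 1, by omega⟩ < d) :
    (clampExtend hm A d : Matrix (Fin n) (Fin n) K).PosDef := by
  have hcl : ∀ i : Fin n, m ≤ (i : ℕ) → clampFin hm i = ⟨m - 1, by omega⟩ := by
    intro i hi
    ext; simp [clampFin]; omega
  have heq : (clampExtend hm A d : Matrix (Fin n) (Fin n) K) =
      A.submatrix (clampFin hm) (clampFin hm) + diagonal (fun i : Fin n =>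
        if m ≤ (i : ℕ) then d - A ⟨m - 1, by omega⟩ ⟨m - 1, by omega⟩ else 0) := by
    ext i j
    by_cases hij : i = j
    · subst hij
      by_cases hi : m ≤ (i : ℕ) <;> simp [clampExtend, hi, hcl]
    · simp [clampExtend, hij]
  rw [heq]
  refine posDef_submatrix_add_diagonal hA _ (fun i => ?_) _ (injOn_clampFin hm) fun i hi => ?_
  · split_ifs
    · exact (sub_pos.2 hd).le
    · exact le_rfl
  · have : m ≤ (i : ℕ) := by simpa using hi
    simpa [this] using hd

end BlowUp

section Reduction

variable {K : Type*} [RCLike K]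

open Matrix

theorem IsPosSemidefSignPreserver.mono_size {n m : ℕ} {f : K → K}
    (hf : IsPosSemidefSignPreserver n f) (hm : 0 < m) (hmn : m ≤ n) :
    IsPosSemidefSignPreserver m f := by
  intro A hA
  have hback : ∀ B : Matrix (Fin m) (Fin m) K,
      (B.submatrix (clampFin (n := n) hm) (clampFin hm)).PosSemidef ↔ B.PosSemidef := by
    refine fun B => ⟨fun h => ?_, fun h => h.submatrix _⟩
    have h' := h.submatrix (Fin.castLE hmn)
    rw [submatrix_submatrix] at h'
    have hid : clampFin (n := n) hm ∘ Fin.castLE hmn = id := funext (clampFin_castLE hm hmn)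
    rwa [hid, submatrix_id_id] at h'
  have h := hf (A.submatrix (clampFin hm) (clampFin hm)) (hA.submatrix _)
  rwa [hback, ← submatrix_map, hback] at h

theorem IsPosSemidefSignPreserver.isWeakSignPreserver {m : ℕ} {f : K → K}
    (hf : IsPosSemidefSignPreserver m f) : IsWeakSignPreserver m f :=
  ⟨fun A hA => (hf A hA.isHermitian).1 hA.posSemidef, fun A hA h => (hf A hA).2 h.posSemidef⟩

theorem posSemidef_hermTwo_self {a b : ℝ} (hb : 0 ≤ b) (h : b ≤ a) :
    (hermTwo a a (b : K)).PosSemidef := by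
  have hsum : hermTwo a a (b : K) =
      b • vecMulVec ![1, 1] (star ![1, 1]) + diagonal fun _ => ((a - b : ℝ) : K) := by
    ext i j; fin_cases i <;> fin_cases j <;>
      simp [hermTwo, -cons_vecMulVec, -vecMulVec_cons, vecMulVec_apply,
        RCLike.real_smul_eq_coe_mul]
  rw [hsum]
  exact ((posSemidef_vecMulVec_self_star _).smul hb).add
    (.diagonal fun _ => RCLike.ofReal_nonneg.2 (sub_nonneg.2 h))

theorem IsPosSemidefSignPreserver.re_map_nonneg {f : K → K}
    (hf : IsPosSemidefSignPreserver 2 f) {x : ℝ} (hx : 0 ≤ x) : 0 ≤ RCLike.re (f x) := by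
  have h := (hf _ (isHermitian_hermTwo x x (x : K))).1 (posSemidef_hermTwo_self hx le_rfl)
  have h0 := h.diag_nonneg (i := 0)
  exact (RCLike.nonneg_iff.1 h0).1

/-- Strict monotonicity on `[0, ∞)`: the matrix `[a, b; b, a]` is not positive semidefinite for
`a < b`. -/
theorem IsPosSemidefSignPreserver.re_map_lt {f : K → K}
    (hf : IsPosSemidefSignPreserver 2 f) {a b : ℝ} (ha : 0 ≤ a) (h : a < b) :
    RCLike.re (f a) < RCLike.re (f b) := by
  by_contra! hle
  have hF := hf.isWeakSignPreserver.1
  have hb := hf.re_map_nonneg (ha.trans h.le)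
  have := (hf _ (isHermitian_hermTwo a a (b : K))).2 (by
    rw [map_hermTwo hF, map_ofReal_of_posSemidef_map hF b]
    exact posSemidef_hermTwo_self hb hle)
  have := norm_sq_le_of_posSemidef_hermTwo this
  rw [RCLike.norm_ofReal, sq_abs] at this
  nlinarith

theorem IsPosSemidefSignPreserver.exists_isometry {n : ℕ} (hn : 3 ≤ n) {f : K → K}
    (hf : IsPosSemidefSignPreserver n f) :
    ∃ c : ℝ, 0 < c ∧ ∃ g : K → K, g 0 = 0 ∧ g 1 = 1 ∧ Isometry g ∧ ∀ z, f z = c * g z := by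
  have hf2 := hf.mono_size (m := 2) two_pos (by omega)
  have hf3 := hf.mono_size (m := 3) three_pos hn
  exact hf2.isWeakSignPreserver.exists_isometry hf3.isWeakSignPreserver
    (fun x hx => (hf2.re_map_nonneg le_rfl).trans_lt (hf2.re_map_lt le_rfl hx))
    (hf2.re_map_lt zero_le_one one_lt_two)

theorem IsPosDefSignPreserver.posDef_map {n m : ℕ} {f : K → K}
    (hf : IsPosDefSignPreserver n f) (hm : 0 < m) (hmn : m ≤ n) {A : Matrix (Fin m) (Fin m) K}
    (hA : A.PosDef) : (A.map f).PosDef := by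
  have h := posDef_clampExtend (n := n) hm hA (d := A ⟨m - 1, by omega⟩ ⟨m - 1, by omega⟩ + 1)
    (by simp)
  have h' := ((hf _ h.isHermitian).1 h).submatrix (e := Fin.castLE hmn) (Fin.castLE_injective hmn)
  rwa [submatrix_map, clampExtend_submatrix] at h'

theorem IsPosDefSignPreserver.re_map_pos {n : ℕ} (hn : 2 ≤ n) {f : K → K}
    (hf : IsPosDefSignPreserver n f) {x : ℝ} (hx : 0 < x) : 0 < RCLike.re (f x) := by
  have h := hf.posDef_map two_pos hn (posDef_hermTwo (a := x) (d := x) (b := (0 : K)) hx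
    (by rw [norm_zero]; nlinarith))
  exact (RCLike.pos_iff.1 (h.diag_pos (i := 0))).1

theorem IsPosDefSignPreserver.re_map_one_lt {n : ℕ} (hn : 2 ≤ n) {f : K → K}
    (hf : IsPosDefSignPreserver n f) : RCLike.re (f (1 : ℝ)) < RCLike.re (f (2 : ℝ)) := by
  have hF := fun (A : Matrix (Fin 2) (Fin 2) K) (hA : A.PosDef) =>
    (hf.posDef_map two_pos hn hA).posSemidef
  have h := (hf.posDef_map two_pos hn (posDef_hermTwo (a := 2) (d := 2) (b := ((1 : ℝ) : K)) two_pos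
    (by norm_num))).det_pos
  rw [map_hermTwo hF, det_hermTwo, RCLike.ofReal_pos, norm_map_ofReal_sq hF] at h
  have := hf.re_map_pos hn two_pos
  exact lt_of_pow_lt_pow_left₀ 2 this.le (by linarith)

/-- For the converse direction, a matrix with positive definite image is enlarged to size `n` with
new diagonal entries whose images are large; these exist because `f` is unbounded. -/
theorem IsPosDefSignPreserver.isWeakSignPreserver {n m : ℕ} (hn : 2 ≤ n) {f : K → K}
    (hf : IsPosDefSignPreserver n f) (hm : 0 < m) (hmn : m ≤ n) : IsWeakSignPreserver m f := by
  refine ⟨fun A hA => (hf.posDef_map hm hmn hA).posSemidef, fun A hA h => ?_⟩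
  have hF := fun (A : Matrix (Fin 2) (Fin 2) K) (hA : A.PosDef) =>
    (hf.posDef_map two_pos hn hA).posSemidef
  obtain ⟨d, -, hd⟩ := exists_lt_re_map hF (fun x hx => hf.re_map_pos hn hx) (hf.re_map_one_lt hn)
    (RCLike.re (f (A ⟨m - 1, by omega⟩ ⟨m - 1, by omega⟩)))
  have hlt : (A.map f) ⟨m - 1, by omega⟩ ⟨m - 1, by omega⟩ < f d := by
    rw [← h.isHermitian.coe_re_apply_self, map_ofReal_of_posSemidef_map hF d]
    exact RCLike.ofReal_lt_ofReal.2 hd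
  have hB := (hf _ (isHermitian_clampExtend hm hA d)).2
    (by rw [map_clampExtend]; exact posDef_clampExtend hm h hlt)
  have := hB.posSemidef.submatrix (Fin.castLE hmn)
  rwa [clampExtend_submatrix] at this

theorem IsPosDefSignPreserver.exists_isometry {n : ℕ} (hn : 3 ≤ n) {f : K → K}
    (hf : IsPosDefSignPreserver n f) :
    ∃ c : ℝ, 0 < c ∧ ∃ g : K → K, g 0 = 0 ∧ g 1 = 1 ∧ Isometry g ∧ ∀ z, f z = c * g z :=
  have hn2 : 2 ≤ n := by omega
  (hf.isWeakSignPreserver hn2 two_pos hn2).exists_isometry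
    (hf.isWeakSignPreserver hn2 three_pos hn) (fun _ hx => hf.re_map_pos hn2 hx)
    (hf.re_map_one_lt hn2)

end Reduction

/-! ### Isometries of the line and the plane fixing `0` and `1` -/

theorem Isometry.eq_self_of_map_zero_one {g : ℝ → ℝ} (hg : Isometry g) (h0 : g 0 = 0)
    (h1 : g 1 = 1) (x : ℝ) : g x = x := by
  have e0 := hg.dist_eq x 0
  have e1 := hg.dist_eq x 1
  rw [h0, Real.dist_eq, Real.dist_eq, ← sq_eq_sq_iff_abs_eq_abs] at e0
  rw [h1, Real.dist_eq, Real.dist_eq, ← sq_eq_sq_iff_abs_eq_abs] at e1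
  linarith

theorem Isometry.eq_self_or_conj_of_map_zero_one {g : ℂ → ℂ} (hg : Isometry g) (h0 : g 0 = 0)
    (h1 : g 1 = 1) : (∀ z, g z = z) ∨ ∀ z, g z = starRingEnd ℂ z := by
  have hd : ∀ z w, ((g z).re - (g w).re) ^ 2 + ((g z).im - (g w).im) ^ 2 =
      (z.re - w.re) ^ 2 + (z.im - w.im) ^ 2 := by
    intro z w
    have h := congrArg (· ^ 2) (hg.dist_eq z w)
    simp only [dist_eq_norm, ← Complex.normSq_eq_norm_sq, Complex.normSq_apply, Complex.sub_re,
      Complex.sub_im] at h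
    linarith
  have hre : ∀ z, (g z).re = z.re := by
    intro z
    have e0 := hd z 0
    have e1 := hd z 1
    simp only [h0, h1, Complex.zero_re, Complex.zero_im, Complex.one_re, Complex.one_im] at e0 e1
    linarith
  have him : ∀ z, (g z).im = z.im ∨ (g z).im = -z.im := by
    intro z
    have e0 := hd z 0
    simp only [h0, hre, Complex.zero_re, Complex.zero_im] at e0
    exact sq_eq_sq_iff_eq_or_eq_neg.1 (by linarith)
  by_cases hall : ∀ z, (g z).im = z.im
  · exact Or.inl fun z => Complex.ext (hre z) (hall z)
  · push Not at hall
    obtain ⟨w, hw⟩ := hall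
    have hw' := (him w).resolve_left hw
    have hw0 : w.im ≠ 0 := fun h => hw (by rw [hw', h, neg_zero])
    refine Or.inr fun z => Complex.ext (by simp [hre]) ?_
    rw [Complex.conj_im]
    rcases him z with hz | hz
    · -- a point kept by `g` and a point conjugated by `g` cannot both be non-real
      have e := hd z w
      rw [hre, hre, hz, hw'] at e
      have : z.im = 0 := (mul_eq_zero.1 (by linarith : z.im * w.im = 0)).resolve_right hw0
      rw [hz, this, neg_zero]
    · exact hz

/-! ### Multiples of the identity and of the conjugation -/

section Converse

variable {K : Type*} [RCLike K]

open Matrix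

theorem posDef_smul_iff {m : Type*} {A : Matrix m m K} {c : ℝ} (hc : 0 < c) :
    (c • A).PosDef ↔ A.PosDef := by
  refine ⟨fun h => ?_, fun h => h.smul hc⟩
  simpa [smul_smul, hc.ne'] using h.smul (inv_pos.2 hc)

theorem posSemidef_smul_iff {m : Type*} {A : Matrix m m K} {c : ℝ} (hc : 0 < c) :
    (c • A).PosSemidef ↔ A.PosSemidef := by
  refine ⟨fun h => ?_, fun h => h.smul hc.le⟩
  simpa [smul_smul, hc.ne'] using h.smul (inv_nonneg.2 hc.le)

theorem map_mul_eq_smul {m : Type*} (A : Matrix m m K) {f : K → K} {c : ℝ}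
    (hf : ∀ z, f z = c * z) : A.map f = c • A := by
  ext i j; simp [hf, RCLike.real_smul_eq_coe_mul]

/-- Entrywise conjugation of a Hermitian matrix is transposition. -/
theorem map_mul_conj_eq_smul_transpose {m : Type*} {A : Matrix m m K} (hA : A.IsHermitian)
    {f : K → K} {c : ℝ} (hf : ∀ z, f z = c * starRingEnd K z) : A.map f = c • Aᵀ := by
  ext i j
  simp [hf, RCLike.real_smul_eq_coe_mul, ← hA.apply j i]

theorem isPosDefSignPreserver_of_eq_mul (n : ℕ) {f : K → K} {c : ℝ} (hc : 0 < c)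
    (hf : (∀ z, f z = c * z) ∨ ∀ z, f z = c * starRingEnd K z) : IsPosDefSignPreserver n f := by
  intro A hA
  rcases hf with hf | hf
  · rw [map_mul_eq_smul A hf, posDef_smul_iff hc]
  · rw [map_mul_conj_eq_smul_transpose hA hf, posDef_smul_iff hc, PosDef.transpose_iff]

theorem isPosSemidefSignPreserver_of_eq_mul (n : ℕ) {f : K → K} {c : ℝ} (hc : 0 < c)
    (hf : (∀ z, f z = c * z) ∨ ∀ z, f z = c * starRingEnd K z) :
    IsPosSemidefSignPreserver n f := by
  intro A hA
  rcases hf with hf | hf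
  · rw [map_mul_eq_smul A hf, posSemidef_smul_iff hc]
  · rw [map_mul_conj_eq_smul_transpose hA hf, posSemidef_smul_iff hc, posSemidef_transpose_iff]

end Converse

theorem isPosMulContinuousAut_real_iff {f : ℝ → ℝ} :
    IsPosMulContinuousAut f ↔ ∃ c : ℝ, 0 < c ∧ ∀ x : ℝ, f x = c * x := by
  constructor
  · rintro ⟨c, hc, σ, -, hf⟩
    have hσ : (σ : ℝ →+* ℝ) = RingHom.id ℝ := Subsingleton.elim _ _
    exact ⟨c, hc, fun x => by rw [hf, smul_eq_mul, show σ x = x from RingHom.congr_fun hσ x]⟩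
  · rintro ⟨c, hc, hf⟩
    exact ⟨c, hc, RingEquiv.refl ℝ, continuous_id, fun x => by simp [hf]⟩

theorem isPosMulContinuousAut_complex_iff {f : ℂ → ℂ} :
    IsPosMulContinuousAut f ↔ ∃ c : ℝ, 0 < c ∧
      ((∀ z : ℂ, f z = (c : ℂ) * z) ∨ (∀ z : ℂ, f z = (c : ℂ) * (starRingEnd ℂ) z)) := by
  constructor
  · rintro ⟨c, hc, σ, hσ, hf⟩
    refine ⟨c, hc, ?_⟩
    rcases Complex.ringHom_eq_id_or_conj_of_continuous (f := (σ : ℂ →+* ℂ)) hσ with h | h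
    · left
      intro z
      rw [hf, Complex.real_smul, show σ z = z from RingHom.congr_fun h z]
    · right
      intro z
      rw [hf, Complex.real_smul, show σ z = starRingEnd ℂ z from RingHom.congr_fun h z]
  · rintro ⟨c, hc, hf | hf⟩
    · exact ⟨c, hc, RingEquiv.refl ℂ, continuous_id, fun x => by simp [hf]⟩
    · exact ⟨c, hc, starRingAut, Complex.continuous_conj, fun x => by
        rw [hf, Complex.real_smul]; rfl⟩

theorem mainTheorem1 (n : ℕ) (hn : 3 ≤ n) :
    (∀ f : ℝ → ℝ,
      List.TFAE [
        IsPosDefSignPreserver n f,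
        IsPosSemidefSignPreserver n f,
        IsPosMulContinuousAut f,
        ∃ c : ℝ, 0 < c ∧ ∀ x : ℝ, f x = c * x]) ∧
    (∀ f : ℂ → ℂ,
      List.TFAE [
        IsPosDefSignPreserver n f,
        IsPosSemidefSignPreserver n f,
        IsPosMulContinuousAut f,
        ∃ c : ℝ, 0 < c ∧
          ((∀ z : ℂ, f z = (c : ℂ) * z) ∨
            (∀ z : ℂ, f z = (c : ℂ) * (starRingEnd ℂ) z))]) := by
  constructor
  · intro f
    have key : (∃ c : ℝ, 0 < c ∧ ∃ g : ℝ → ℝ, g 0 = 0 ∧ g 1 = 1 ∧ Isometry g ∧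
        ∀ z, f z = c * g z) → ∃ c : ℝ, 0 < c ∧ ∀ x : ℝ, f x = c * x := by
      rintro ⟨c, hc, g, h0, h1, hg, hf⟩
      exact ⟨c, hc, fun x => by rw [hf, hg.eq_self_of_map_zero_one h0 h1]⟩
    tfae_have 1 → 4 := fun h => key (h.exists_isometry hn)
    tfae_have 2 → 4 := fun h => key (h.exists_isometry hn)
    tfae_have 3 ↔ 4 := isPosMulContinuousAut_real_iff
    tfae_have 4 → 1 := fun ⟨c, hc, hf⟩ => isPosDefSignPreserver_of_eq_mul n hc (Or.inl hf)
    tfae_have 4 → 2 := fun ⟨c, hc, hf⟩ => isPosSemidefSignPreserver_of_eq_mul n hc (Or.inl hf)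
    tfae_finish
  · intro f
    have key : (∃ c : ℝ, 0 < c ∧ ∃ g : ℂ → ℂ, g 0 = 0 ∧ g 1 = 1 ∧ Isometry g ∧
        ∀ z, f z = c * g z) → ∃ c : ℝ, 0 < c ∧ ((∀ z : ℂ, f z = (c : ℂ) * z) ∨
          (∀ z : ℂ, f z = (c : ℂ) * (starRingEnd ℂ) z)) := by
      rintro ⟨c, hc, g, h0, h1, hg, hf⟩
      refine ⟨c, hc, (hg.eq_self_or_conj_of_map_zero_one h0 h1).imp ?_ ?_⟩ <;>
        exact fun h z => by rw [hf, h]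
    tfae_have 1 → 4 := fun h => key (h.exists_isometry hn)
    tfae_have 2 → 4 := fun h => key (h.exists_isometry hn)
    tfae_have 3 ↔ 4 := isPosMulContinuousAut_complex_iff
    tfae_have 4 → 1 := fun ⟨c, hc, hf⟩ => isPosDefSignPreserver_of_eq_mul n hc hf
    tfae_have 4 → 2 := fun ⟨c, hc, hf⟩ => isPosSemidefSignPreserver_of_eq_mul n hc hf
    tfae_finish
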